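/- Let $\mathbb{K}$ be a field of characteristic zero and let $\mathcal{S}$ be a signature, that is, a set with an arity map $\mathcal{S}\to\mathbb{N}$. Let $\mathfrak{T}(\mathcal{S})$ be the free nonsymmetric operad on $\mathcal{S}$. Its elements are the $\mathcal{S}$-terms, i.e. the planar rooted trees whose internal nodes with $n$ children are decorated by elements of $\mathcal{S}$ of arity $n$; the arity of a term is its number of leaves, its degree is its number of internal nodes, the unit is the tree reduced to one leaf, and $t[t_1,\dots,t_n]$ is obtained by grafting $t_i$ onto the $i$-th leaf of $t$. For an operad $\mathcal{O}$ with unit $\mathbf{1}$ in which every element $x$ has finitely many factorizations $x=y[w_1,\dots,w_n]$, and which admits a grading (a map $\deg:\mathcal{O}\to\mathbb{N}$, additive under composition, with $\deg^{-1}(0)=\{\mathbf{1}\}$), the natural Hopf algebra $\mathbf{N}(\mathcal{O})$ is the $\mathbb{K}$-vector space with basis $(\mathsf{E}_w)$ indexed by the reduced words $w\in(\mathcal{O}\setminus\{\mathbf{1}\})^*$. Its product is $\mathsf{E}_v\cdot\mathsf{E}_w=\mathsf{E}_{vw}$, and its coproduct is the algebra morphism such that, for $x\in\mathcal{O}\setminus\{\mathbf{1}\}$,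 $$\Delta(\mathsf{E}_x)=\sum_{x=y[w_1,\dots,w_n]}\mathsf{E}_{\mathrm{rd}(y)}\otimes\mathsf{E}_{\mathrm{rd}(w_1\cdots w_n)},$$ where the sum is over all factorizations of $x$ and $\mathrm{rd}$ removes from a word all letters equal to $\mathbf{1}$. Let $\equiv$ be an operad congruence of $\mathfrak{T}(\mathcal{S})$, i.e. an equivalence relation which preserves arities and is compatible with composition. Assume that $\equiv$ is compatible with the degree ($t\equiv t'$ implies $\deg t=\deg t'$) and of finite type (all its equivalence classes are finite). Let $\pi$ be the projection from words on $\mathfrak{T}(\mathcal{S})$ to words on $\mathfrak{T}(\mathcal{S})/_\equiv$ which replaces each letter by its class. Then $\mathfrak{T}(\mathcal{S})/_\equiv$ and $\mathfrak{T}(\mathcal{S})$ have natural Hopf algebras, and the linear map $$\phi:\mathbf{N}(\mathfrak{T}(\mathcal{S})/_\equiv)\to\mathbf{N}(\mathfrak{T}(\mathcal{S})),\qquad \phi(\mathsf{E}_x)=\sum_{f}\mathsf{E}_f,$$ where for each reduced word $x$ on $\mathfrak{T}(\mathcal{S})/_\equiv$ the sum is over the (finitely many) reduced forests $f$, i.e.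 words on the terms other than the leaf, such that $\pi(f)=x$, is an injective morphism of Hopf algebras: it is an injective linear map that preserves product, unit, coproduct, counit and antipode. -/

import Mathlib

open scoped TensorProduct

/-! ### Signatures and nonsymmetric operads -/

/-- A signature: a set endowed with an arity map. -/
structure Signature where
  carrier : Type*
  arity : carrier → ℕ

/-- A nonsymmetric (set-theoretic) operad. The inputs of a composite `x[y₁, …, yₙ]` are numbered
block by block, which is what `finSigmaFinEquiv` does. -/
structure NSOperad extends Signature where
  unit : carrier
  comp : (x : carrier) → (Fin (arity x) → carrier) → carrier
  arity_unit : arity unit = 1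
  arity_comp : ∀ x y, arity (comp x y) = ∑ i, arity (y i)
  unit_comp : ∀ x, comp unit (fun _ => x) = x
  comp_unit : ∀ x, comp x (fun _ => unit) = x
  comp_assoc : ∀ x y (z : Fin (arity (comp x y)) → carrier),
    comp (comp x y) z =
      comp x fun i => comp (y i) fun j =>
        z (Fin.cast (arity_comp x y).symm (finSigmaFinEquiv ⟨i, j⟩))

namespace NSOperad

variable (O : NSOperad)

/-- The factorizations `x = y[y'₁, …, y'ₙ]` of `x`. -/
def Factorization (x : O.carrier) :=
  {p : (y : O.carrier) × (Fin (O.arity y) → O.carrier) // O.comp p.1 p.2 = x}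

class FinitelyFactorizable : Prop where
  finite : ∀ x : O.carrier, Finite (O.Factorization x)

/-- `deg` is a grading of the operad `O`. -/
structure IsGrading (deg : O.carrier → ℕ) : Prop where
  eq_zero_iff : ∀ x, deg x = 0 ↔ x = O.unit
  comp : ∀ x y, deg (O.comp x y) = deg x + ∑ i, deg (y i)

class Graded : Prop where
  exists_grading : ∃ deg : O.carrier → ℕ, O.IsGrading deg

end NSOperad

/-! ### Numbering of the inputs of a composite -/

theorem finSigmaFinEquiv_lt_iff {m : ℕ} {n : Fin m → ℕ} (a b : (i : Fin m) × Fin (n i)) :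
    finSigmaFinEquiv a < finSigmaFinEquiv b ↔
      a.1 < b.1 ∨ (a.1 = b.1 ∧ (a.2 : ℕ) < b.2) := by
  have key : ∀ a b : (i : Fin m) × Fin (n i), a.1 < b.1 →
      finSigmaFinEquiv a < finSigmaFinEquiv b := by
    rintro ⟨i, j⟩ ⟨i', j'⟩ h
    rw [Fin.lt_def, finSigmaFinEquiv_apply, finSigmaFinEquiv_apply]
    simp only at h ⊢
    have h1 : ∑ k : Fin (i : ℕ), n (Fin.castLE i.2.le k) + n i
        = ∑ k : Fin (i + 1 : ℕ), n (Fin.castLE i.2 k) := by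
      rw [Fin.sum_univ_castSucc]; rfl
    have h2 : ∑ k : Fin (i + 1 : ℕ), n (Fin.castLE i.2 k)
        ≤ ∑ k : Fin (i' : ℕ), n (Fin.castLE i'.2.le k) := by
      have h3 : (i : ℕ) + 1 ≤ i' := h
      obtain ⟨d, hd⟩ := Nat.exists_eq_add_of_le h3
      have : ∑ k : Fin (i' : ℕ), n (Fin.castLE i'.2.le k)
        = ∑ k : Fin ((i + 1 : ℕ) + d), n (Fin.castLE (hd ▸ i'.2.le) k) := by
        refine Fintype.sum_equiv (finCongr hd) _ _ fun k => ?_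
        rfl
      rw [this, Fin.sum_univ_add (b := d)]
      exact Nat.le_add_right _ _
    have := j.2
    omega
  have key2 : ∀ (i : Fin m) (j j' : Fin (n i)),
      finSigmaFinEquiv (⟨i, j⟩ : (i : Fin m) × Fin (n i)) < finSigmaFinEquiv ⟨i, j'⟩ ↔
        (j : ℕ) < j' := by
    intro i j j'
    rw [Fin.lt_def, finSigmaFinEquiv_apply, finSigmaFinEquiv_apply]
    simp
  obtain ⟨i, j⟩ := a
  obtain ⟨i', j'⟩ := b
  rcases lt_trichotomy i i' with h | h | h
  · simp [h, key ⟨i, j⟩ ⟨i', j'⟩ h]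
  · subst h
    simp [key2 i j j']
  · have := key ⟨i', j'⟩ ⟨i, j⟩ h
    simp [this.not_gt, h.not_gt, h.ne']

theorem finSigmaFinEquiv_val {m : ℕ} {n : Fin m → ℕ} (i : Fin m) (j : Fin (n i)) :
    (finSigmaFinEquiv (⟨i, j⟩ : (i : Fin m) × Fin (n i)) : ℕ) =
      ∑ k ∈ Finset.univ.filter (· < i), n k + j := by
  rw [finSigmaFinEquiv_apply]
  congr 1
  refine Finset.sum_bij (fun k _ => Fin.castLE i.2.le k) ?_ ?_ ?_ ?_
  · intro k _; simpa using Fin.lt_def.2 k.2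
  · intro k _ l _ h; simpa [Fin.ext_iff] using h
  · intro k hk
    simp only [Finset.mem_filter, Finset.mem_univ, true_and] at hk
    exact ⟨⟨k, hk⟩, Finset.mem_univ _, rfl⟩
  · intro k _; rfl

theorem finSigmaFinEquiv_symm_apply' {α : Type*} {m : ℕ} {n : Fin m → ℕ}
    (v : ∀ i, Fin (n i) → α) (i : Fin m) (j : Fin (n i)) :
    v (finSigmaFinEquiv.symm (finSigmaFinEquiv ⟨i, j⟩)).1
      (finSigmaFinEquiv.symm (finSigmaFinEquiv ⟨i, j⟩)).2 = v i j := by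
  have h : ∀ q : (i : Fin m) × Fin (n i), q = ⟨i, j⟩ → v q.1 q.2 = v i j := by
    rintro _ rfl
    rfl
  exact h _ (Equiv.symm_apply_apply _ _)

/-- Numbering blocks of blocks of inputs does not depend on the order of the grouping. -/
theorem finSigmaFinEquiv_assoc {m : ℕ} {n : Fin m → ℕ} (a : Fin (∑ i, n i) → ℕ)
    (i : Fin m) (j : Fin (n i)) (k : Fin (a (finSigmaFinEquiv ⟨i, j⟩))) (b : Fin m → ℕ)
    (hb : ∀ i, b i = ∑ j, a (finSigmaFinEquiv ⟨i, j⟩)) :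
    (finSigmaFinEquiv (⟨i, Fin.cast (hb i).symm (finSigmaFinEquiv
        (⟨j, k⟩ : (j : Fin (n i)) × Fin (a (finSigmaFinEquiv ⟨i, j⟩))))⟩ :
          (i : Fin m) × Fin (b i)) : ℕ) =
      (finSigmaFinEquiv (⟨finSigmaFinEquiv ⟨i, j⟩, k⟩ : (l : Fin (∑ i, n i)) × Fin (a l)) : ℕ) := by
  rw [finSigmaFinEquiv_val, finSigmaFinEquiv_val, Fin.val_cast, finSigmaFinEquiv_val, ← add_assoc]
  congr 1
  rw [Finset.sum_filter, Finset.sum_filter, Finset.sum_filter]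
  rw [← Equiv.sum_comp finSigmaFinEquiv, Fintype.sum_sigma]
  simp only [finSigmaFinEquiv_lt_iff]
  have h1 : ∀ x : Fin m, (∑ y : Fin (n x), if x < i ∨ (x = i ∧ (y : ℕ) < j) then
      a (finSigmaFinEquiv ⟨x, y⟩) else 0) =
      (if x < i then b x else 0) +
        (if x = i then ∑ y : Fin (n i), (if y < j then a (finSigmaFinEquiv ⟨i, y⟩) else 0)
          else 0) := by
    intro x
    rcases lt_trichotomy x i with h | h | h
    · simp [h, h.ne, hb]
    · subst h
      simp
    · simp [h.not_gt, h.ne']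
  rw [Finset.sum_congr rfl fun x _ => h1 x, Finset.sum_add_distrib]
  simp

theorem ofFn_finSigmaFinEquiv {α : Type*} {m : ℕ} {n : Fin m → ℕ} (g : Fin (∑ i, n i) → α) :
    List.ofFn g =
      (List.ofFn fun i => List.ofFn fun j : Fin (n i) => g (finSigmaFinEquiv ⟨i, j⟩)).flatten := by
  induction m with
  | zero => simp
  | succ m ih =>
    have hs := Fin.sum_univ_castSucc n
    rw [List.ofFn_congr hs, List.ofFn_add, List.ofFn_succ', List.concat_eq_append,
      List.flatten_append, ih]
    congr 1
    · congr 2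
      funext i
      congr 1
      funext j
      congr 1
      apply Fin.ext
      simp [finSigmaFinEquiv_apply]
    · simp only [List.flatten_cons, List.flatten_nil, List.append_nil]
      congr 1
      funext j
      congr 1
      apply Fin.ext
      simp [finSigmaFinEquiv_apply]
      rfl

/-! ### Terms and free operads -/

/-- The terms on a signature. -/
inductive Term (S : Signature) where
  | leaf : Term S
  | node (s : S.carrier) (c : Fin (S.arity s) → Term S) : Term S

namespace Term

variable {S : Signature}

/-- The number of internal nodes. -/
def deg : Term S → ℕ
  | leaf => 0
  | node _ c => 1 + ∑ i, (c i).deg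

/-- The number of leaves. -/
def arity : Term S → ℕ
  | leaf => 1
  | node _ c => ∑ i, (c i).arity

/-- Grafting of the `i`-th term of `y` onto the `i`-th leaf of a term, from left to right. -/
def graft : (t : Term S) → (Fin t.arity → Term S) → Term S
  | leaf, y => y (0 : Fin 1)
  | node s c, y => node s fun i => (c i).graft fun j =>
      y (finSigmaFinEquiv (n := fun i => (c i).arity) ⟨i, j⟩)

theorem arity_graft (t : Term S) (y : Fin t.arity → Term S) :
    (t.graft y).arity = ∑ i, (y i).arity := by
  induction t with
  | leaf => exact (Fin.sum_univ_one fun i : Fin 1 => (y i).arity).symm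
  | node s c ih =>
    rw [graft, arity]
    simp only [ih]
    rw [← Fintype.sum_sigma']
    exact Equiv.sum_comp (finSigmaFinEquiv (n := fun i => (c i).arity)) (fun k => (y k).arity)

theorem deg_graft (t : Term S) (y : Fin t.arity → Term S) :
    (t.graft y).deg = t.deg + ∑ i, (y i).deg := by
  induction t with
  | leaf =>
    rw [graft, deg, zero_add]
    exact (Fin.sum_univ_one fun i : Fin 1 => (y i).deg).symm
  | node s c ih =>
    rw [graft, deg, deg]
    simp only [ih]
    rw [Finset.sum_add_distrib, add_assoc]
    congr 2
    rw [← Fintype.sum_sigma']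
    exact Equiv.sum_comp (finSigmaFinEquiv (n := fun i => (c i).arity)) (fun k => (y k).deg)

theorem graft_leaf (t : Term S) : t.graft (fun _ => leaf) = t := by
  induction t with
  | leaf => rfl
  | node s c ih =>
    rw [graft]
    simp only [ih]

theorem graft_assoc (t : Term S) (y : Fin t.arity → Term S)
    (z : Fin (t.graft y).arity → Term S) :
    (t.graft y).graft z = t.graft fun i => (y i).graft fun j =>
      z (Fin.cast (arity_graft t y).symm (finSigmaFinEquiv ⟨i, j⟩)) := by
  induction t with
  | leaf =>
    change (y (0 : Fin 1)).graft z = (y (0 : Fin 1)).graft _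
    congr 1
    funext j
    congr 1
    apply Fin.ext
    exact (finSigmaFinEquiv_one (n := fun i : Fin 1 => (y i).arity) ⟨0, j⟩).symm
  | node s c ih =>
    change node s _ = node s _
    congr 1
    funext i
    refine (ih i _ _).trans ?_
    congr 1
    funext j
    congr 1
    funext k
    congr 1
    apply Fin.ext
    exact finSigmaFinEquiv_assoc (n := fun i => (c i).arity) (fun l => (y l).arity) i j k
      (fun i => ((c i).graft fun j => y (finSigmaFinEquiv ⟨i, j⟩)).arity)
      (fun i => arity_graft _ _)

end Term

/-- The free operad on a signature. -/
def freeOperad (S : Signature) : NSOperad where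
  carrier := Term S
  arity := Term.arity
  unit := Term.leaf
  comp := Term.graft
  arity_unit := rfl
  arity_comp := Term.arity_graft
  unit_comp _ := rfl
  comp_unit := Term.graft_leaf
  comp_assoc := Term.graft_assoc

theorem Term.deg_eq_zero_iff {S : Signature} (t : Term S) : t.deg = 0 ↔ t = Term.leaf := by
  cases t with
  | leaf => simp [Term.deg]
  | node s c => simp [Term.deg]

theorem freeOperad_isGrading_deg (S : Signature) : (freeOperad S).IsGrading Term.deg where
  eq_zero_iff := Term.deg_eq_zero_iff
  comp := Term.deg_graft

instance freeOperad_graded (S : Signature) : (freeOperad S).Graded :=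
  ⟨⟨_, freeOperad_isGrading_deg S⟩⟩

instance freeOperad_finitelyFactorizable (S : Signature) :
    (freeOperad S).FinitelyFactorizable := by
  refine ⟨fun t => ?_⟩
  change Finite {p : (y : Term S) × (Fin y.arity → Term S) // p.1.graft p.2 = t}
  induction t with
  | leaf =>
    have : ∀ p : {p : (y : Term S) × (Fin y.arity → Term S) // p.1.graft p.2 = Term.leaf},
        p = ⟨⟨Term.leaf, fun _ => Term.leaf⟩, rfl⟩ := by
      rintro ⟨⟨y, w⟩, h⟩
      cases y with
      | leaf =>
        have : w = fun _ => Term.leaf := by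
          funext (i : Fin 1)
          rw [Subsingleton.elim i 0]
          exact h
        subst this
        rfl
      | node s c => simp [Term.graft] at h
    have : Subsingleton {p : (y : Term S) × (Fin y.arity → Term S) //
        p.1.graft p.2 = Term.leaf} := ⟨fun a b => by rw [this a, this b]⟩
    infer_instance
  | node s c ih =>
    let F : Option (∀ i, {p : (y : Term S) × (Fin y.arity → Term S) // p.1.graft p.2 = c i}) →
        {p : (y : Term S) × (Fin y.arity → Term S) // p.1.graft p.2 = Term.node s c} :=
      fun o => match o with
      | none => ⟨⟨Term.leaf, fun _ => Term.node s c⟩, rfl⟩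
      | some p => ⟨⟨Term.node s fun i => (p i).1.1, fun k =>
          (p (finSigmaFinEquiv.symm k).1).1.2 (finSigmaFinEquiv.symm k).2⟩, by
          rw [Term.graft]
          congr 1
          funext i
          refine Eq.trans ?_ (p i).2
          congr 1
          funext j
          exact finSigmaFinEquiv_symm_apply' (fun i => (p i).1.2) i j⟩
    refine Finite.of_surjective F ?_
    rintro ⟨⟨y, w⟩, h⟩
    cases y with
    | leaf =>
      refine ⟨none, ?_⟩
      apply Subtype.ext
      have : w = fun _ => Term.node s c := by
        funext (i : Fin 1)
        rw [Subsingleton.elim i 0]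
        exact h
      subst this
      rfl
    | node s' c' =>
      simp only [Term.graft] at h
      injection h with h1 h2
      subst h1
      have h2 := eq_of_heq h2
      subst h2
      refine ⟨some fun i => ⟨⟨c' i, fun j => w (finSigmaFinEquiv (n := fun i => (c' i).arity)
        ⟨i, j⟩)⟩, rfl⟩, ?_⟩
      apply Subtype.ext
      simp only [F]
      congr 1
      funext k
      exact congrArg w (Equiv.apply_symm_apply (finSigmaFinEquiv (n := fun i => (c' i).arity)) k)

/-! ### Congruences and quotients of operads -/

namespace NSOperad

variable (O : NSOperad)

/-- An operad congruence: an equivalence relation which preserves the arities and is compatible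
with the composition. -/
structure Congruence extends Setoid O.carrier where
  arity_eq : ∀ {x x' : O.carrier}, r x x' → O.arity x = O.arity x'
  comp_congr : ∀ {x x' : O.carrier} (h : r x x') (y : Fin (O.arity x) → O.carrier)
    (y' : Fin (O.arity x') → O.carrier), (∀ i, r (y i) (y' (Fin.cast (arity_eq h) i))) →
    r (O.comp x y) (O.comp x' y')

namespace Congruence

variable {O} (C : O.Congruence)

/-- The set of equivalence classes. -/
def Class := Quotient C.toSetoid

/-- The canonical projection. -/
def proj (x : O.carrier) : C.Class := Quotient.mk C.toSetoid x

theorem proj_eq_iff {x x' : O.carrier} : C.proj x = C.proj x' ↔ C.r x x' :=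
  Quotient.eq (r := C.toSetoid)

theorem proj_surjective : Function.Surjective C.proj := Quotient.mk_surjective

/-- The common arity of the elements of a class. -/
def classArity : C.Class → ℕ := Quotient.lift O.arity fun _ _ h => C.arity_eq h

/-- A representative of a class. -/
noncomputable def rep (q : C.Class) : O.carrier := Quotient.out q

theorem proj_rep (q : C.Class) : C.proj (C.rep q) = q := Quotient.out_eq q

theorem arity_rep (q : C.Class) : O.arity (C.rep q) = C.classArity q := by
  conv_rhs => rw [← C.proj_rep q]
  rfl

/-- The class of the composite of representatives; by `proj_comp` it does not depend on them. -/
noncomputable def classComp (q : C.Class) (y : Fin (C.classArity q) → C.Class) : C.Class :=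
  C.proj (O.comp (C.rep q) fun i => C.rep (y (Fin.cast (C.arity_rep q) i)))

theorem proj_comp (x : O.carrier) (y : Fin (O.arity x) → O.carrier) :
    C.proj (O.comp x y) = C.classComp (C.proj x) fun i => C.proj (y i) := by
  refine C.proj_eq_iff.2 (C.comp_congr (C.proj_eq_iff.1 (C.proj_rep _).symm) _ _ fun i => ?_)
  exact C.proj_eq_iff.1 (C.proj_rep _).symm

/-- The quotient operad. -/
noncomputable def quotient : NSOperad where
  carrier := C.Class
  arity := C.classArity
  unit := C.proj O.unit
  comp := C.classComp
  arity_unit := O.arity_unit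
  arity_comp q y := by
    obtain ⟨x, rfl⟩ := C.proj_surjective q
    have : ∀ i, ∃ z, C.proj z = y i := fun i => C.proj_surjective _
    choose z hz using this
    obtain rfl : (fun i => C.proj (z i)) = y := funext hz
    exact (congrArg C.classArity (C.proj_comp x z).symm).trans (O.arity_comp x z)
  unit_comp q := by
    obtain ⟨x, rfl⟩ := C.proj_surjective q
    exact (C.proj_comp O.unit fun _ => x).symm.trans (congrArg C.proj (O.unit_comp x))
  comp_unit q := by
    obtain ⟨x, rfl⟩ := C.proj_surjective q
    exact (C.proj_comp x fun _ => O.unit).symm.trans (congrArg C.proj (O.comp_unit x))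
  comp_assoc q y z := by
    obtain ⟨x, rfl⟩ := C.proj_surjective q
    have : ∀ i, ∃ z, C.proj z = y i := fun i => C.proj_surjective _
    choose v hv using this
    obtain rfl : (fun i => C.proj (v i)) = y := funext hv
    have h := C.proj_comp x v
    have : ∀ i, ∃ u, C.proj u = z i := fun i => C.proj_surjective _
    choose u hu using this
    obtain rfl : (fun i => C.proj (u i)) = z := funext hu
    have key : ∀ (c : C.Class) (hc : C.proj (O.comp x v) = c)
        (u : Fin (C.classArity c) → O.carrier),
        C.classComp c (fun i => C.proj (u i)) = C.classComp (C.proj x) fun i =>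
          C.classComp (C.proj (v i)) fun j => C.proj (u (Fin.cast
            ((O.arity_comp x v).symm.trans (congrArg C.classArity hc))
              (finSigmaFinEquiv ⟨i, j⟩))) := by
      rintro c rfl u
      refine (C.proj_comp (O.comp x v) u).symm.trans ?_
      rw [O.comp_assoc x v u, C.proj_comp]
      congr 1
      funext i
      rw [C.proj_comp]
      rfl
    exact key _ h u

end Congruence

end NSOperad

namespace NSOperad.Congruence

variable {S : Signature} (C : (freeOperad S).Congruence)

/-- Equivalent terms have the same degree. -/
class CompatibleWithDegree : Prop where
  deg_eq : ∀ t t' : Term S, C.r t t' → t.deg = t'.deg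

/-- All equivalence classes are finite. -/
class FiniteType : Prop where
  finite : ∀ t : Term S, {t' : Term S | C.r t t'}.Finite

instance quotient_graded [h : C.CompatibleWithDegree] : C.quotient.Graded := by
  let d : C.Class → ℕ := Quotient.lift Term.deg h.deg_eq
  refine ⟨⟨d, ?_, ?_⟩⟩
  · intro q
    obtain ⟨x, rfl⟩ := C.proj_surjective q
    refine (Term.deg_eq_zero_iff x).trans ⟨fun hx => congrArg C.proj hx, fun hx => ?_⟩
    exact (Term.deg_eq_zero_iff x).1 (h.deg_eq _ _ (C.proj_eq_iff.1 hx))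
  · intro q y
    obtain ⟨x, rfl⟩ := C.proj_surjective q
    have : ∀ i, ∃ z, C.proj z = y i := fun i => C.proj_surjective _
    choose z hz using this
    obtain rfl : (fun i => C.proj (z i)) = y := funext hz
    exact (congrArg d (C.proj_comp x z).symm).trans (Term.deg_graft x z)

instance quotient_finitelyFactorizable [h : C.FiniteType] :
    C.quotient.FinitelyFactorizable := by
  refine ⟨fun q => ?_⟩
  obtain ⟨t, rfl⟩ := C.proj_surjective q
  have h1 : Finite {t' : Term S | C.r t t'} := h.finite t
  have h2 : ∀ t' : Term S, Finite ((freeOperad S).Factorization t') :=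
    NSOperad.FinitelyFactorizable.finite (O := freeOperad S)
  let F : ((t' : {t' : Term S | C.r t t'}) × (freeOperad S).Factorization t'.1) →
      C.quotient.Factorization (C.proj t) := fun p =>
    ⟨⟨C.proj p.2.1.1, fun i => C.proj (p.2.1.2 i)⟩, by
      refine (C.proj_comp p.2.1.1 p.2.1.2).symm.trans ?_
      rw [p.2.2]
      exact (C.proj_eq_iff.2 p.1.2).symm⟩
  refine Finite.of_surjective F ?_
  rintro ⟨⟨q, y⟩, hq⟩
  obtain ⟨x, rfl⟩ := C.proj_surjective q
  have : ∀ i, ∃ z, C.proj z = y i := fun i => C.proj_surjective _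
  choose z hz using this
  obtain rfl : (fun i => C.proj (z i)) = y := funext hz
  refine ⟨⟨⟨(freeOperad S).comp x z, ?_⟩, ⟨⟨x, z⟩, rfl⟩⟩, rfl⟩
  exact C.proj_eq_iff.1 (hq.symm.trans (C.proj_comp x z).symm)

end NSOperad.Congruence

/-! ### Natural Hopf algebras -/

noncomputable section

namespace NSOperad

variable (O : NSOperad)

/-- The reduced words: the words on the elements of `O` other than the unit. -/
abbrev ReducedWord := FreeMonoid {x : O.carrier // x ≠ O.unit}

/-- The reduced word made of the letters of a word other than the unit. -/
def rd (w : List O.carrier) : O.ReducedWord :=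
  open Classical in
  FreeMonoid.ofList (w.filterMap fun x => if h : x ≠ O.unit then some ⟨x, h⟩ else none)

theorem rd_nil : O.rd [] = 1 := rfl

theorem rd_append (v w : List O.carrier) : O.rd (v ++ w) = O.rd v * O.rd w := by
  simp [rd, List.filterMap_append, FreeMonoid.ofList_append]

theorem rd_unit : O.rd [O.unit] = 1 := by
  simp [rd]

theorem rd_singleton (x : {x : O.carrier // x ≠ O.unit}) : O.rd [x.1] = FreeMonoid.of x := by
  simp [rd, x.2]

theorem rd_flatten (l : List (List O.carrier)) : O.rd l.flatten = (l.map O.rd).prod := by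
  induction l with
  | nil => rfl
  | cons a l ih => simp [rd_append, ih]

theorem rd_ofFn {n : ℕ} (w : Fin n → O.carrier) :
    O.rd (List.ofFn w) = (List.ofFn fun i => O.rd [w i]).prod := by
  induction n with
  | zero => rfl
  | succ n ih =>
    rw [List.ofFn_succ, List.ofFn_succ, List.prod_cons, ← ih, ← rd_append]
    rfl

/-- The underlying space of the natural Hopf algebra: finite linear combinations of reduced
words, with the concatenation product. -/
def NatHopf (K : Type*) [CommRing K] : Type _ := MonoidAlgebra K O.ReducedWord

namespace NatHopf

variable (K : Type*) [CommRing K]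

instance : Ring (O.NatHopf K) := inferInstanceAs (Ring (MonoidAlgebra K O.ReducedWord))

instance : Algebra K (O.NatHopf K) := inferInstanceAs (Algebra K (MonoidAlgebra K O.ReducedWord))

/-- The elementary basis. -/
def E : Module.Basis O.ReducedWord K (O.NatHopf K) := MonoidAlgebra.basis O.ReducedWord K

/-- The algebra morphism with prescribed values on the generators `E x`, for `x` in `O` other
than the unit. -/
def lift {A : Type*} [Semiring A] [Algebra K A] (f : {x : O.carrier // x ≠ O.unit} → A) :
    O.NatHopf K →ₐ[K] A :=
  MonoidAlgebra.lift K A O.ReducedWord (FreeMonoid.lift f)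

variable {O}

theorem E_mul (v w : O.ReducedWord) : E O K v * E O K w = E O K (v * w) := by
  refine (MonoidAlgebra.single_mul_single ..).trans ?_
  rw [one_mul]
  rfl

theorem E_one : E O K 1 = 1 := rfl

theorem lift_E {A : Type*} [Semiring A] [Algebra K A] (f : {x : O.carrier // x ≠ O.unit} → A)
    (w : O.ReducedWord) : lift O K f (E O K w) = FreeMonoid.lift f w := by
  refine (MonoidAlgebra.lift_single ..).trans ?_
  rw [one_smul]

theorem algHom_ext {A : Type*} [Semiring A] [Algebra K A] {f g : O.NatHopf K →ₐ[K] A}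
    (h : ∀ x, f (E O K (FreeMonoid.of x)) = g (E O K (FreeMonoid.of x))) : f = g := by
  apply AlgHom.toLinearMap_injective
  refine (E O K).ext fun w => ?_
  induction w using FreeMonoid.recOn with
  | one => rw [E_one]; simp
  | of_mul x w ih =>
    rw [← E_mul]
    simp only [AlgHom.toLinearMap_apply, map_mul] at ih ⊢
    rw [h, ih]

variable (O) in
/-- The coproduct of `E x`: the sum of `E (rd y) ⊗ E (rd w)` over all factorizations
`x = y[w₁, …, wₙ]`. -/
def comulGen (x : O.carrier) : O.NatHopf K ⊗[K] O.NatHopf K :=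
  ∑ᶠ p : O.Factorization x, E O K (O.rd [p.1.1]) ⊗ₜ[K] E O K (O.rd (List.ofFn p.1.2))

variable (O) in
/-- The coproduct, an algebra morphism. -/
def comulHom : O.NatHopf K →ₐ[K] O.NatHopf K ⊗[K] O.NatHopf K :=
  lift O K fun x => comulGen O K x.1

variable (O) in
/-- The counit, an algebra morphism which vanishes on the reduced words other than the empty
one. -/
def counitHom : O.NatHopf K →ₐ[K] K := lift O K fun _ => 0

theorem counitHom_E_rd (l : List O.carrier) :
    counitHom O K (E O K (O.rd l)) =
      open Classical in if ∀ x ∈ l, x = O.unit then 1 else 0 := by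
  induction l with
  | nil => simp [rd_nil, E_one]
  | cons x l ih =>
    have h1 : x :: l = [x] ++ l := rfl
    rw [congrArg O.rd h1, rd_append, ← E_mul, map_mul, ih]
    by_cases hx : x = O.unit
    · subst hx
      rw [rd_unit, E_one, map_one, one_mul]
      by_cases hl : ∀ x ∈ l, x = O.unit
      · rw [if_pos hl, if_pos (by simpa using hl)]
      · rw [if_neg hl, if_neg (by simpa using hl)]
    · rw [rd_singleton O ⟨x, hx⟩, counitHom, lift_E]
      rw [FreeMonoid.lift_eval_of, zero_mul, if_neg]
      exact fun h => hx (h x List.mem_cons_self)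

theorem prod_ofFn_sum {A : Type*} [Semiring A] {n : ℕ} {F : Fin n → Type*} [∀ i, Fintype (F i)]
    (f : ∀ i, F i → A) :
    (List.ofFn fun i => ∑ p, f i p).prod = ∑ p : ∀ i, F i, (List.ofFn fun i => f i (p i)).prod := by
  induction n with
  | zero => simp
  | succ n ih =>
    rw [List.ofFn_succ, List.prod_cons, ih, Finset.sum_mul_sum, ← Fintype.sum_prod_type',
      ← (Fin.consEquiv F).sum_comp]
    refine Finset.sum_congr rfl fun p _ => ?_
    simp [List.ofFn_succ, Fin.consEquiv]

theorem prod_ofFn_tmul {n : ℕ} (a b : Fin n → O.ReducedWord) :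
    (List.ofFn fun i => E O K (a i) ⊗ₜ[K] E O K (b i)).prod =
      E O K (List.ofFn a).prod ⊗ₜ[K] E O K (List.ofFn b).prod := by
  induction n with
  | zero => simp [E_one, Algebra.TensorProduct.one_def]
  | succ n ih =>
    simp [List.ofFn_succ, ih, ← E_mul, Algebra.TensorProduct.tmul_mul_tmul]

variable (O) in
/-- The two-level factorizations `x = (y[u₁, …, uₙ])[z₁, …, zₘ]`. -/
def Factorization₂ (x : O.carrier) :=
  {p : (y : O.carrier) × (u : Fin (O.arity y) → O.carrier) ×
    (Fin (O.arity (O.comp y u)) → O.carrier) // O.comp (O.comp p.1 p.2.1) p.2.2 = x}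

def equivLeft (x : O.carrier) :
    Factorization₂ O x ≃ (p : O.Factorization x) × O.Factorization p.1.1 where
  toFun p := ⟨⟨⟨O.comp p.1.1 p.1.2.1, p.1.2.2⟩, p.2⟩, ⟨⟨p.1.1, p.1.2.1⟩, rfl⟩⟩
  invFun p := ⟨⟨p.2.1.1, p.2.1.2, fun i => p.1.1.2 (Fin.cast (congrArg O.arity p.2.2) i)⟩, by
    obtain ⟨⟨⟨y', z⟩, h⟩, ⟨⟨y, u⟩, h'⟩⟩ := p
    simp only at h'
    subst h'
    exact h⟩
  left_inv p := rfl
  right_inv p := by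
    obtain ⟨⟨⟨y', z⟩, h⟩, ⟨⟨y, u⟩, h'⟩⟩ := p
    simp only at h'
    subst h'
    rfl

def toRight (x : O.carrier) (p : Factorization₂ O x) :
    (p : O.Factorization x) × ∀ i, O.Factorization (p.1.2 i) :=
  ⟨⟨⟨p.1.1, fun i => O.comp (p.1.2.1 i) fun j =>
    p.1.2.2 (Fin.cast (O.arity_comp _ _).symm (finSigmaFinEquiv ⟨i, j⟩))⟩,
      (O.comp_assoc _ _ _).symm.trans p.2⟩, fun i => ⟨⟨p.1.2.1 i, fun j =>
        p.1.2.2 (Fin.cast (O.arity_comp _ _).symm (finSigmaFinEquiv ⟨i, j⟩))⟩, rfl⟩⟩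

def ofRight (x : O.carrier) (p : (p : O.Factorization x) × ∀ i, O.Factorization (p.1.2 i)) :
    (y : O.carrier) × (u : Fin (O.arity y) → O.carrier) ×
      (Fin (O.arity (O.comp y u)) → O.carrier) :=
  ⟨p.1.1.1, fun i => (p.2 i).1.1, fun k =>
      (p.2 (finSigmaFinEquiv.symm (Fin.cast (O.arity_comp _ _) k)).1).1.2
        (finSigmaFinEquiv.symm (Fin.cast (O.arity_comp _ _) k)).2⟩

theorem toRight_bijective (x : O.carrier) : Function.Bijective (toRight (O := O) x) := by
  constructor
  · have h : ∀ p, ofRight x (toRight x p) = p.1 := by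
      rintro ⟨⟨y, u, z⟩, h⟩
      refine Sigma.ext rfl (heq_of_eq (Sigma.ext rfl (heq_of_eq ?_)))
      funext k
      change z _ = z k
      congr 1
      apply Fin.ext
      have := Equiv.apply_symm_apply (finSigmaFinEquiv (n := fun i => O.arity (u i)))
        (Fin.cast (O.arity_comp y u) k)
      rw [Fin.ext_iff] at this
      exact this
    intro p q hpq
    exact Subtype.ext ((h p).symm.trans ((congrArg (ofRight x) hpq).trans (h q)))
  · rintro ⟨⟨⟨y, w⟩, h⟩, p⟩
    obtain ⟨u, hu, rfl⟩ : ∃ (u : (i : Fin (O.arity y)) →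
        (v : O.carrier) × (Fin (O.arity v) → O.carrier))
        (hu : ∀ i, O.comp (u i).1 (u i).2 = w i), p = fun i => ⟨u i, hu i⟩ :=
      ⟨fun i => (p i).1, fun i => (p i).2, rfl⟩
    obtain rfl : (fun i => O.comp (u i).1 (u i).2) = w := funext hu
    obtain ⟨a, z, rfl⟩ : ∃ (a : Fin (O.arity y) → O.carrier)
        (z : Fin (O.arity (O.comp y a)) → O.carrier),
        u = fun i => ⟨a i, fun j =>
          z (Fin.cast (O.arity_comp _ _).symm (finSigmaFinEquiv ⟨i, j⟩))⟩ := by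
      refine ⟨fun i => (u i).1, fun k =>
        (u (finSigmaFinEquiv.symm (Fin.cast (O.arity_comp _ _) k)).1).2
          (finSigmaFinEquiv.symm (Fin.cast (O.arity_comp _ _) k)).2, ?_⟩
      funext i
      refine Sigma.ext rfl (heq_of_eq ?_)
      funext j
      exact (finSigmaFinEquiv_symm_apply' (fun i => (u i).2) i j).symm
    exact ⟨⟨⟨y, a, z⟩, (O.comp_assoc _ _ _).trans h⟩, rfl⟩

theorem comulGen_eq (x : O.carrier) [Fintype (O.Factorization x)] :
    comulGen O K x =
      ∑ p : O.Factorization x, E O K (O.rd [p.1.1]) ⊗ₜ[K] E O K (O.rd (List.ofFn p.1.2)) :=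
  finsum_eq_sum_of_fintype _

section

variable [hf : O.FinitelyFactorizable]

instance (x : O.carrier) : Fintype (O.Factorization x) :=
  have := hf.finite x
  Fintype.ofFinite _

variable [hg : O.Graded]

theorem comulGen_unit : comulGen O K O.unit = 1 := by
  obtain ⟨deg, hd⟩ := hg.exists_grading
  rw [comulGen_eq]
  have key : ∀ p : O.Factorization O.unit, p.1.1 = O.unit ∧ ∀ i, p.1.2 i = O.unit := by
    rintro ⟨⟨y, w⟩, h⟩
    have h1 := hd.comp y w
    simp only at h
    rw [h, (hd.eq_zero_iff _).2 rfl] at h1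
    have h2 : deg y = 0 := by omega
    have h3 : ∑ i, deg (w i) = 0 := by omega
    refine ⟨(hd.eq_zero_iff _).1 h2, fun i => (hd.eq_zero_iff _).1 ?_⟩
    exact (Finset.sum_eq_zero_iff.1 h3) i (Finset.mem_univ _)
  let p₀ : O.Factorization O.unit := ⟨⟨O.unit, fun _ => O.unit⟩, O.unit_comp _⟩
  rw [Finset.sum_eq_single p₀]
  · have h2 : List.ofFn (fun _ : Fin (O.arity O.unit) => O.unit) = [O.unit] := by
      rw [List.ofFn_congr O.arity_unit]
      simp
    simp only [p₀]
    rw [h2, rd_unit, E_one]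
    rfl
  · rintro p - hp
    exfalso
    apply hp
    obtain ⟨⟨y, w⟩, h⟩ := p
    obtain ⟨h1, h2⟩ := key ⟨⟨y, w⟩, h⟩
    simp only at h1 h2
    subst h1
    obtain rfl : w = fun _ => O.unit := funext h2
    rfl
  · simp

theorem comulHom_E_rd_singleton (x : O.carrier) :
    comulHom O K (E O K (O.rd [x])) = comulGen O K x := by
  by_cases hx : x = O.unit
  · subst hx
    rw [rd_unit, E_one, map_one, comulGen_unit]
  · rw [rd_singleton O ⟨x, hx⟩, comulHom, lift_E, FreeMonoid.lift_eval_of]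

theorem comulHom_E_rd (l : List O.carrier) :
    comulHom O K (E O K (O.rd l)) = (l.map (comulGen O K)).prod := by
  induction l with
  | nil => simp [rd_nil, E_one]
  | cons x l ih =>
    have h1 : x :: l = [x] ++ l := rfl
    rw [h1, rd_append, ← E_mul, map_mul, ih, comulHom_E_rd_singleton]
    simp


instance (x : O.carrier) : Fintype (Factorization₂ O x) :=
  Fintype.ofEquiv _ (equivLeft x).symm

variable (O) in
theorem comulHom_coassoc :
    (Algebra.TensorProduct.assoc K K K (O.NatHopf K) (O.NatHopf K) (O.NatHopf K)).toAlgHom.comp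
      ((Algebra.TensorProduct.map (comulHom O K) (.id K _)).comp (comulHom O K)) =
    (Algebra.TensorProduct.map (.id K _) (comulHom O K)).comp (comulHom O K) := by
  refine algHom_ext K fun x => ?_
  obtain ⟨x, hx⟩ := x
  rw [← rd_singleton O ⟨x, hx⟩]
  have h1 : (Algebra.TensorProduct.map (comulHom O K) (.id K _)) (comulGen O K x) =
      ∑ q : Factorization₂ O x, (E O K (O.rd [q.1.1]) ⊗ₜ[K] E O K (O.rd (List.ofFn q.1.2.1)))
        ⊗ₜ[K] E O K (O.rd (List.ofFn q.1.2.2)) := by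
    rw [comulGen_eq, map_sum]
    simp only [Algebra.TensorProduct.map_tmul, comulHom_E_rd_singleton, comulGen_eq,
      TensorProduct.sum_tmul, AlgHom.id_apply]
    rw [← Fintype.sum_sigma', ← (equivLeft x).sum_comp]
    rfl
  have h2 : (Algebra.TensorProduct.map (.id K _) (comulHom O K)) (comulGen O K x) =
      ∑ q : Factorization₂ O x, E O K (O.rd [q.1.1]) ⊗ₜ[K] (E O K (O.rd (List.ofFn q.1.2.1))
        ⊗ₜ[K] E O K (O.rd (List.ofFn q.1.2.2))) := by
    have h3 : ∀ {n : ℕ} (w : Fin n → O.carrier), comulHom O K (E O K (O.rd (List.ofFn w))) =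
        ∑ p : ∀ i, O.Factorization (w i), E O K (O.rd (List.ofFn fun i => (p i).1.1)) ⊗ₜ[K]
          E O K (O.rd (List.ofFn fun i => List.ofFn (p i).1.2).flatten) := by
      intro n w
      rw [comulHom_E_rd, List.map_ofFn]
      refine (congrArg (fun f => (List.ofFn f).prod) (funext fun i => comulGen_eq K (w i))).trans ?_
      rw [prod_ofFn_sum]
      refine Finset.sum_congr rfl fun p _ => ?_
      rw [prod_ofFn_tmul, rd_flatten, List.map_ofFn]
      congr 2
      exact (rd_ofFn O _).symm
    rw [comulGen_eq, map_sum]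
    simp only [Algebra.TensorProduct.map_tmul, h3, TensorProduct.tmul_sum, AlgHom.id_apply]
    rw [← Fintype.sum_sigma', ← (toRight_bijective x).sum_comp]
    refine Finset.sum_congr rfl fun q _ => ?_
    congr 3
    rw [List.ofFn_congr (O.arity_comp q.1.1 q.1.2.1), ofFn_finSigmaFinEquiv]
    rfl
  simp only [AlgHom.comp_apply, comulHom_E_rd_singleton]
  rw [h1, h2]
  simp

variable (O) in
theorem comulHom_rTensor :
    (Algebra.TensorProduct.map (counitHom O K) (.id K _)).comp (comulHom O K) =
      (Algebra.TensorProduct.lid K (O.NatHopf K)).symm := by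
  refine algHom_ext K fun x => ?_
  obtain ⟨x, hx⟩ := x
  rw [← rd_singleton O ⟨x, hx⟩]
  simp only [AlgHom.comp_apply, comulHom_E_rd_singleton]
  rw [comulGen_eq, map_sum]
  let p₀ : O.Factorization x := ⟨⟨O.unit, fun _ => x⟩, O.unit_comp x⟩
  rw [Finset.sum_eq_single p₀]
  · have h2 : List.ofFn (fun _ : Fin (O.arity O.unit) => x) = [x] := by
      rw [List.ofFn_congr O.arity_unit]
      simp
    simp [p₀, h2, counitHom_E_rd]
  · rintro ⟨⟨y, w⟩, h⟩ - hp
    have : y ≠ O.unit := by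
      rintro rfl
      apply hp
      simp only at h
      have h3 : w = fun _ => w (Fin.cast O.arity_unit.symm 0) := by
        funext i
        congr 1
        apply Fin.ext
        have := i.2
        have := O.arity_unit
        simp
        omega
      rw [h3, O.unit_comp] at h
      rw [h] at h3
      subst h3
      rfl
    simp [counitHom_E_rd, this]
  · simp

variable (O) in
theorem comulHom_lTensor :
    (Algebra.TensorProduct.map (.id K _) (counitHom O K)).comp (comulHom O K) =
      (Algebra.TensorProduct.rid K K (O.NatHopf K)).symm := by
  refine algHom_ext K fun x => ?_
  obtain ⟨x, hx⟩ := x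
  rw [← rd_singleton O ⟨x, hx⟩]
  simp only [AlgHom.comp_apply, comulHom_E_rd_singleton]
  rw [comulGen_eq, map_sum]
  let p₀ : O.Factorization x := ⟨⟨x, fun _ => O.unit⟩, O.comp_unit x⟩
  rw [Finset.sum_eq_single p₀]
  · simp [p₀, counitHom_E_rd]
  · rintro ⟨⟨y, w⟩, h⟩ - hp
    have : ¬ ∀ i, w i = O.unit := by
      intro hw
      apply hp
      simp only at h
      obtain rfl : w = fun _ => O.unit := funext hw
      rw [O.comp_unit] at h
      subst h
      rfl
    have h4 : ¬ ∀ a ∈ List.ofFn w, a = O.unit := by simpa [List.mem_ofFn] using this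
    rw [Algebra.TensorProduct.map_tmul, counitHom_E_rd, if_neg h4, TensorProduct.tmul_zero]
  · simp

/-- The bialgebra structure: the product is the concatenation of reduced words, the coproduct is
`comulHom`, the counit is `counitHom`. -/
instance : Bialgebra K (O.NatHopf K) :=
  Bialgebra.ofAlgHom (comulHom O K) (counitHom O K) (comulHom_coassoc O K)
    (comulHom_rTensor O K) (comulHom_lTensor O K)

end

theorem conv_ext {f g : WithConv (O.NatHopf K →ₗ[K] O.NatHopf K)}
    (h : ∀ w, f (E O K w) = g (E O K w)) : f = g :=
  WithConv.ofConv_injective ((E O K).ext h)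

section

variable [O.Graded]

variable (O) in
/-- The sum of the degrees of the letters of a reduced word, for some grading of `O`. -/
def wordDeg (w : O.ReducedWord) : ℕ :=
  (w.toList.map fun x => (Graded.exists_grading (O := O)).choose x.1).sum

theorem wordDeg_mul (v w : O.ReducedWord) : wordDeg O (v * w) = wordDeg O v + wordDeg O w := by
  simp [wordDeg, FreeMonoid.toList_mul]

theorem wordDeg_rd (l : List O.carrier) :
    wordDeg O (O.rd l) = (l.map (Graded.exists_grading (O := O)).choose).sum := by
  have hd := (Graded.exists_grading (O := O)).choose_spec
  induction l with
  | nil => rfl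
  | cons x l ih =>
    have h1 : x :: l = [x] ++ l := rfl
    rw [h1, rd_append, wordDeg_mul, ih]
    by_cases hx : x = O.unit
    · subst hx
      rw [rd_unit]
      simp [(hd.eq_zero_iff _).2 rfl, wordDeg]
    · rw [rd_singleton O ⟨x, hx⟩]
      simp [wordDeg]

theorem wordDeg_eq_zero (w : O.ReducedWord) (h : wordDeg O w = 0) : w = 1 := by
  have hd := (Graded.exists_grading (O := O)).choose_spec
  induction w using FreeMonoid.recOn with
  | one => rfl
  | of_mul x w ih =>
    exfalso
    rw [wordDeg_mul] at h
    have h1 : wordDeg O (FreeMonoid.of x) = 0 := by omega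
    rw [← rd_singleton O x, wordDeg_rd] at h1
    exact x.2 ((hd.eq_zero_iff _).1 (by simpa using h1))

variable (O) in
/-- The homogeneous component of degree `n` of the tensor square. -/
def tensorDeg (n : ℕ) : Submodule K (O.NatHopf K ⊗[K] O.NatHopf K) :=
  Submodule.span K {t | ∃ a b, wordDeg O a + wordDeg O b = n ∧ t = E O K a ⊗ₜ[K] E O K b}

variable [O.FinitelyFactorizable]

theorem comul_mem_tensorDeg (w : O.ReducedWord) :
    comulHom O K (E O K w) ∈ tensorDeg O K (wordDeg O w) := by
  have hd := (Graded.exists_grading (O := O)).choose_spec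
  induction w using FreeMonoid.recOn with
  | one =>
    rw [E_one, map_one]
    exact Submodule.subset_span ⟨1, 1, rfl, rfl⟩
  | of_mul x w ih =>
    rw [← E_mul, map_mul, wordDeg_mul]
    have h1 : comulHom O K (E O K (FreeMonoid.of x)) ∈
        tensorDeg O K (wordDeg O (FreeMonoid.of x)) := by
      rw [← rd_singleton O x, comulHom_E_rd_singleton, comulGen_eq]
      refine Submodule.sum_mem _ fun p _ => Submodule.subset_span ⟨_, _, ?_, rfl⟩
      rw [wordDeg_rd, wordDeg_rd, wordDeg_rd]
      have h2 := hd.comp p.1.1 p.1.2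
      rw [p.2] at h2
      simp [h2, List.sum_ofFn, List.map_ofFn]
    have h3 := Submodule.mul_mem_mul h1 ih
    rw [tensorDeg, tensorDeg, Submodule.span_mul_span] at h3
    refine Submodule.span_mono ?_ h3
    rintro _ ⟨_, ⟨a, b, hab, rfl⟩, _, ⟨c, d, hcd, rfl⟩, rfl⟩
    refine ⟨a * c, b * d, ?_, ?_⟩
    · rw [wordDeg_mul, wordDeg_mul, ← hab, ← hcd]
      ring
    · simp [← E_mul, Algebra.TensorProduct.tmul_mul_tmul]

open WithConv

theorem convMul_congr (w : O.ReducedWord) (f g f' g' : WithConv (O.NatHopf K →ₗ[K] O.NatHopf K))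
    (h : ∀ a b, wordDeg O a + wordDeg O b = wordDeg O w →
      f (E O K a) * g (E O K b) = f' (E O K a) * g' (E O K b)) :
    (f * g) (E O K w) = (f' * g') (E O K w) := by
  rw [LinearMap.convMul_apply, LinearMap.convMul_apply]
  refine LinearMap.eqOn_span (f := LinearMap.mul' K _ ∘ₗ TensorProduct.map f.ofConv g.ofConv)
    (g := LinearMap.mul' K _ ∘ₗ TensorProduct.map f'.ofConv g'.ofConv) ?_
    (comul_mem_tensorDeg K w)
  rintro _ ⟨a, b, hab, rfl⟩
  exact h a b hab

variable (O) in
/-- The convolution unit minus the identity. -/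
def oneSubId : WithConv (O.NatHopf K →ₗ[K] O.NatHopf K) := 1 - toConv LinearMap.id

theorem oneSubId_E_one : oneSubId O K (E O K 1) = 0 := by
  simp [oneSubId, E_one]

theorem oneSubId_pow (n : ℕ) (w : O.ReducedWord) (h : wordDeg O w < n) :
    (oneSubId O K ^ n) (E O K w) = 0 := by
  induction n generalizing w with
  | zero => omega
  | succ n ih =>
    rw [pow_succ', convMul_congr K w _ _ 0 0, zero_mul]
    · rfl
    · intro a b hab
      by_cases ha : wordDeg O a = 0
      · rw [wordDeg_eq_zero a ha, oneSubId_E_one, zero_mul]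
        exact (zero_mul _).symm
      · rw [ih b (by omega), mul_zero]
        exact (zero_mul _).symm

variable (O) in
/-- The antipode, as a geometric series for the convolution product. -/
def antipodeMap : O.NatHopf K →ₗ[K] O.NatHopf K :=
  (E O K).constr K fun w => (∑ k ∈ Finset.range (wordDeg O w + 1), oneSubId O K ^ k) (E O K w)

theorem antipodeMap_E (w : O.ReducedWord) (n : ℕ) (h : wordDeg O w < n) :
    antipodeMap O K (E O K w) = (∑ k ∈ Finset.range n, oneSubId O K ^ k) (E O K w) := by
  rw [antipodeMap, Module.Basis.constr_basis]
  have : ∀ m, (∑ k ∈ Finset.range m, oneSubId O K ^ k) (E O K w) =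
      ∑ k ∈ Finset.range m, (oneSubId O K ^ k) (E O K w) := by
    intro m
    induction m with
    | zero => rfl
    | succ m ih => rw [Finset.sum_range_succ, Finset.sum_range_succ, ← ih]; rfl
  rw [this, this]
  refine Finset.sum_subset (Finset.range_mono h) fun k _ hk => oneSubId_pow K k w ?_
  simpa using hk

theorem toConv_id : toConv LinearMap.id = 1 - oneSubId O K := by
  simp [oneSubId]

theorem one_sub_pow_E (w : O.ReducedWord) :
    (1 - oneSubId O K ^ (wordDeg O w + 1)) (E O K w) =
      (1 : WithConv (O.NatHopf K →ₗ[K] O.NatHopf K)) (E O K w) := by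
  refine Eq.trans (b := (1 : WithConv (O.NatHopf K →ₗ[K] O.NatHopf K)) (E O K w) -
    (oneSubId O K ^ (wordDeg O w + 1)) (E O K w)) rfl ?_
  rw [oneSubId_pow K _ w (Nat.lt_succ_self _), sub_zero]

theorem antipodeMap_conv_id : toConv (antipodeMap O K) * toConv LinearMap.id = 1 := by
  refine conv_ext K fun w => ?_
  rw [convMul_congr K w _ _ (∑ k ∈ Finset.range (wordDeg O w + 1), oneSubId O K ^ k)
    (1 - oneSubId O K), geom_sum_mul_neg, one_sub_pow_E]
  intro a b hab
  rw [← toConv_id, ← antipodeMap_E K a _ (by omega)]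

theorem id_conv_antipodeMap : toConv LinearMap.id * toConv (antipodeMap O K) = 1 := by
  refine conv_ext K fun w => ?_
  rw [convMul_congr K w _ _ (1 - oneSubId O K)
    (∑ k ∈ Finset.range (wordDeg O w + 1), oneSubId O K ^ k), mul_neg_geom_sum, one_sub_pow_E]
  intro a b hab
  rw [← toConv_id, ← antipodeMap_E K b _ (by omega)]

/-- The natural Hopf algebra of a finitely factorizable graded operad. -/
instance : HopfAlgebra K (O.NatHopf K) :=
  HopfAlgebra.ofConvInverse (antipodeMap O K) (antipodeMap_conv_id K) (id_conv_antipodeMap K)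

end

end NatHopf

end NSOperad

/-! ### The morphism -/

namespace NSOperad.Congruence

variable {S : Signature} (C : (freeOperad S).Congruence)

/-- The reduced forests which project, letter by letter, to the reduced word `x` of classes. -/
def forestsOver (x : C.quotient.ReducedWord) : Set (freeOperad S).ReducedWord :=
  {f | f.toList.map (fun t => C.proj t.1) = x.toList.map Subtype.val}

/-- The linear map sending `E x` to the sum of `E f` over the reduced forests `f` projecting
to `x`. -/
def phi (K : Type*) [CommRing K] : C.quotient.NatHopf K →ₗ[K] (freeOperad S).NatHopf K :=
  (NatHopf.E C.quotient K).constr K fun x => ∑ᶠ f ∈ C.forestsOver x, NatHopf.E (freeOperad S) K f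

end NSOperad.Congruence

end

/-! The map `phi` is dual to the letterwise projection of forests. The coefficient of `E f` in `phi
a` is the coefficient in `a` of the word of classes of `f` (`repr_phi`). Every reduced word of
classes is the projection of a forest, so `phi` is injective.

Compatibility with the degree makes the leaf alone in its class, so projecting letters commutes with
deleting units; finite type makes all the sums finite. A forest over a concatenation `q x` splits
uniquely into a term of the class `q` and a forest over `x`. Hence `phi` is the algebra morphism
sending the generator of a class to the sum of its elements (`toLinearMap_phiAlgHom`), and the
coalgebra axioms need only be checked on generators.

For the coproduct of a class `q`, both sides are sums over the same data. To choose a factorization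
`q = r[w₁, …, wₙ]` and then elements `y` of `r` and `uᵢ` of `wᵢ` is to choose an element `t` of `q`
and a factorization `t = y[u₁, …, uₙ]`: the term `t` must be the composite, which lies in `q`
because the projection is a morphism of operads (`liftFactorization_bijective`). The counit is
immediate, and the antipode follows because convolution inverses are unique
(`BialgHom.map_antipode`). -/

noncomputable section

/-! ### Antipodes and bialgebra morphisms -/

/-- Morphisms of bialgebras between Hopf algebras commute with the antipodes. -/
theorem BialgHom.map_antipode {R A B : Type*} [CommSemiring R] [Semiring A] [Semiring B]
    [HopfAlgebra R A] [HopfAlgebra R B] (f : A →ₐc[R] B) (a : A) :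
    f (HopfAlgebra.antipode R a) = HopfAlgebra.antipode R (f a) := by
  -- In the convolution algebra of linear maps from `A` to `B`, the two sides of the identity, `G`
  -- and `H`, are a left and a right inverse of `F`, hence equal.
  let F : WithConv (A →ₗ[R] B) := .toConv (f : A →ₗc[R] B).toLinearMap
  let G : WithConv (A →ₗ[R] B) :=
    .toConv ((f : A →ₐ[R] B).toLinearMap ∘ₗ HopfAlgebra.antipode R)
  let H : WithConv (A →ₗ[R] B) :=
    .toConv (HopfAlgebra.antipode R ∘ₗ (f : A →ₗc[R] B).toLinearMap)
  -- Composing with an algebra morphism on the left respects convolution: push the antipode identity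
  -- of `A` forward along `f`.
  have hG : G * F = 1 := by
    have h := LinearMap.algHom_comp_convMul_distrib (f : A →ₐ[R] B)
      (.toConv (HopfAlgebra.antipode R)) (.toConv LinearMap.id : WithConv (A →ₗ[R] A))
    rw [LinearMap.antipode_mul_id] at h
    refine WithConv.ofConv_injective (h.symm.trans ?_)
    ext x
    simpa using AlgHomClass.commutes f (Coalgebra.counit (R := R) x)
  -- Composing with a coalgebra morphism on the right respects convolution: pull the antipode
  -- identity of `B` back along `f`.
  have hH : F * H = 1 := by
    have h := LinearMap.convMul_comp_coalgHom_distrib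
      (.toConv LinearMap.id : WithConv (B →ₗ[R] B)) (.toConv (HopfAlgebra.antipode R))
      (f : A →ₗc[R] B)
    rw [LinearMap.id_mul_antipode] at h
    refine WithConv.ofConv_injective (h.symm.trans ?_)
    ext x
    simp
  exact congrArg (fun g : WithConv (A →ₗ[R] B) => g a) (left_inv_eq_right_inv hG hH)

/-! ### Fibers of the projection on terms and on forests -/

namespace NSOperad.Congruence

/-- The elements of a class. -/
def Fiber {O : NSOperad} (C : O.Congruence) (q : C.quotient.carrier) := {x : O.carrier // C.proj x = q}

variable {S : Signature} (C : (freeOperad S).Congruence)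

theorem finite_fiber [h : C.FiniteType] (q : C.quotient.carrier) : Finite (C.Fiber q) := by
  obtain ⟨t, rfl⟩ := C.proj_surjective q
  exact ((h.finite t).subset fun t' ht' => C.proj_eq_iff.1 (Eq.symm ht')).to_subtype

instance [C.FiniteType] (q : C.quotient.carrier) : Fintype (C.Fiber q) :=
  have := C.finite_fiber q
  Fintype.ofFinite _

/-- The leaf is the only term of degree 0, and equivalent terms have equal degrees. This is what
lets reduced words project to reduced words. -/
theorem proj_eq_unit_iff [h : C.CompatibleWithDegree] (t : (freeOperad S).carrier) :
    C.proj t = C.quotient.unit ↔ t = (freeOperad S).unit := by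
  refine ⟨fun ht => ?_, fun ht => congrArg C.proj ht⟩
  exact (Term.deg_eq_zero_iff t).1 (h.deg_eq _ _ (C.proj_eq_iff.1 ht))

/-- The class of a term other than the leaf, as a letter of the reduced words of classes. -/
def projLetter [C.CompatibleWithDegree]
    (t : {t : (freeOperad S).carrier // t ≠ (freeOperad S).unit}) :
    {q : C.quotient.carrier // q ≠ C.quotient.unit} :=
  ⟨C.proj t.1, fun h => t.2 ((C.proj_eq_unit_iff t.1).1 h)⟩

/-- The reduced word of the classes of the letters of a reduced forest. -/
def projWord [C.CompatibleWithDegree] : (freeOperad S).ReducedWord →* C.quotient.ReducedWord :=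
  FreeMonoid.map C.projLetter

theorem projWord_of_mul [C.CompatibleWithDegree]
    (t : {t : (freeOperad S).carrier // t ≠ (freeOperad S).unit})
    (f : (freeOperad S).ReducedWord) :
    C.projWord (FreeMonoid.of t * f) = FreeMonoid.of (C.projLetter t) * C.projWord f :=
  rfl

/-- Presents the forests over a word as a fiber of a morphism of free monoids, so that induction on
words applies. -/
theorem mem_forestsOver [C.CompatibleWithDegree] {x : C.quotient.ReducedWord}
    {f : (freeOperad S).ReducedWord} : f ∈ C.forestsOver x ↔ C.projWord f = x := by
  rw [← FreeMonoid.toList.injective.eq_iff, ← Subtype.val_injective.list_map.eq_iff]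
  have h : (C.projWord f).toList.map Subtype.val = f.toList.map fun t => C.proj t.1 :=
    (congrArg _ (FreeMonoid.toList_map _ _)).trans List.map_map
  rw [h]
  rfl

theorem projWord_surjective [C.CompatibleWithDegree] : Function.Surjective C.projWord := by
  intro x
  induction x using FreeMonoid.recOn with
  | one => exact ⟨1, map_one _⟩
  | of_mul q x ih =>
    obtain ⟨f, rfl⟩ := ih
    obtain ⟨q, hq⟩ := q
    obtain ⟨t, rfl⟩ := C.proj_surjective q
    exact ⟨FreeMonoid.of ⟨t, fun h => hq ((C.proj_eq_unit_iff t).2 h)⟩ * f, rfl⟩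

theorem forestsOver_one [C.CompatibleWithDegree] : C.forestsOver 1 = {1} := by
  ext f
  rw [mem_forestsOver, Set.mem_singleton_iff]
  refine ⟨fun h => ?_, fun h => by rw [h, map_one]⟩
  exact List.map_eq_nil_iff.1 h

/-- The first tree of the forest is an arbitrary element of `q`, automatically different from the
leaf since `q` is not the class of the unit. Writing it as `rd [t]` avoids carrying that proof
along. -/
theorem mem_forestsOver_of_mul [C.CompatibleWithDegree]
    {q : {q : C.quotient.carrier // q ≠ C.quotient.unit}} {x : C.quotient.ReducedWord}
    {f : (freeOperad S).ReducedWord} :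
    f ∈ C.forestsOver (FreeMonoid.of q * x) ↔
      ∃ (t : C.Fiber q.1) (g : (freeOperad S).ReducedWord), g ∈ C.forestsOver x ∧
        (freeOperad S).rd [t.1] * g = f := by
  simp only [mem_forestsOver]
  constructor
  · intro h
    obtain ⟨t, g, h1, h2, h3⟩ := List.map_eq_cons_iff.1 h
    refine ⟨⟨t.1, congrArg Subtype.val h2⟩, g, h3, ?_⟩
    rw [(freeOperad S).rd_singleton t]
    exact h1.symm
  · rintro ⟨⟨t, ht⟩, g, rfl, rfl⟩
    have hu : t ≠ (freeOperad S).unit := by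
      rintro rfl
      exact q.2 ht.symm
    rw [(freeOperad S).rd_singleton ⟨t, hu⟩, projWord_of_mul]
    congr 2
    exact Subtype.ext ht

/-- As `q` is not the unit class, `rd [t]` is a word of exactly one letter, and a word determines
its first letter and its tail. -/
theorem rd_fiber_mul_injective
    (q : {q : C.quotient.carrier // q ≠ C.quotient.unit}) :
    Function.Injective fun p : C.Fiber q.1 × (freeOperad S).ReducedWord =>
      (freeOperad S).rd [p.1.1] * p.2 := by
  have hu : ∀ t : C.Fiber q.1, t.1 ≠ (freeOperad S).unit := by
    rintro ⟨_, ht⟩ rfl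
    exact q.2 ht.symm
  rintro ⟨t, f⟩ ⟨t', f'⟩ h
  simp only [(freeOperad S).rd_singleton ⟨_, hu t⟩, (freeOperad S).rd_singleton ⟨_, hu t'⟩] at h
  obtain ⟨h1, h2⟩ := List.cons_eq_cons.1 h
  exact Prod.ext (Subtype.ext (Subtype.mk.inj h1)) h2

theorem finite_forestsOver [C.CompatibleWithDegree] [C.FiniteType] (x : C.quotient.ReducedWord) :
    (C.forestsOver x).Finite := by
  induction x using FreeMonoid.recOn with
  | one => simp [forestsOver_one]
  | of_mul q x ih =>
    refine (Set.Finite.image2 (fun (t : C.Fiber q.1) g => (freeOperad S).rd [t.1] * g)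
      Set.finite_univ ih).subset fun f hf => ?_
    obtain ⟨t, g, hg, rfl⟩ := C.mem_forestsOver_of_mul.1 hf
    exact ⟨t, trivial, g, hg, rfl⟩

/-! ### Coordinates of `phi`, injectivity and multiplicativity -/

section Morphism

open NatHopf

variable (K : Type*) [CommRing K]

theorem phi_E [C.CompatibleWithDegree] [C.FiniteType] (x : C.quotient.ReducedWord) :
    C.phi K (E C.quotient K x) =
      ∑ f ∈ (C.finite_forestsOver x).toFinset, E (freeOperad S) K f := by
  rw [phi, Module.Basis.constr_basis, finsum_mem_eq_finite_toFinset_sum]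

/-- The coefficient of `E f` in `phi a` is the coefficient in `a` of the class of `f`. -/
theorem repr_phi [C.CompatibleWithDegree] [C.FiniteType] (a : C.quotient.NatHopf K)
    (f : (freeOperad S).ReducedWord) :
    (E (freeOperad S) K).repr (C.phi K a) f = (E C.quotient K).repr a (C.projWord f) := by
  classical
  -- Both sides are linear in `a`; on the basis element `E x` each is 1 if `f` projects to `x` and 0
  -- otherwise.
  have h : (E (freeOperad S) K).coord f ∘ₗ C.phi K = (E C.quotient K).coord (C.projWord f) := by
    refine (E C.quotient K).ext fun x => ?_
    simp [phi_E, Finsupp.single_apply, mem_forestsOver, eq_comm]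
  exact LinearMap.congr_fun h a

/-- Each word of classes is `projWord f` for some forest `f`, so every coefficient of `a` can be
read off from `phi a`. -/
theorem phi_injective [C.CompatibleWithDegree] [C.FiniteType] :
    Function.Injective (C.phi K) := by
  intro a b h
  refine (E C.quotient K).ext_elem fun x => ?_
  obtain ⟨f, rfl⟩ := C.projWord_surjective x
  rw [← repr_phi, ← repr_phi, h]

variable [C.FiniteType]

/-- The sum of `E t` over the elements `t` of a class. -/
def fiberSum (q : C.quotient.carrier) : (freeOperad S).NatHopf K :=
  ∑ t : C.Fiber q, E (freeOperad S) K ((freeOperad S).rd [t.1])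

/-- The algebra morphism sending the generator `E q` to the sum of the `E t` over the elements `t`
of the class `q`. -/
def phiAlgHom : C.quotient.NatHopf K →ₐ[K] (freeOperad S).NatHopf K :=
  lift C.quotient K fun q => C.fiberSum K q.1

variable [C.CompatibleWithDegree]

/-- Concatenation is a bijection from pairs (element of `q`, forest over `x`) to forests over the
word `q x`. -/
theorem phi_E_of_mul (q : {q : C.quotient.carrier // q ≠ C.quotient.unit})
    (x : C.quotient.ReducedWord) :
    C.phi K (E C.quotient K (FreeMonoid.of q * x)) =
      C.fiberSum K q.1 * C.phi K (E C.quotient K x) := by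
  rw [phi_E, phi_E, fiberSum, Finset.sum_mul_sum, ← Finset.sum_product']
  symm
  refine Finset.sum_bij (fun p _ => (freeOperad S).rd [p.1.1] * p.2) ?_ ?_ ?_ ?_
  · rintro ⟨t, g⟩ h
    simp only [Finset.mem_product, Set.Finite.mem_toFinset] at h ⊢
    exact C.mem_forestsOver_of_mul.2 ⟨t, g, h.2, rfl⟩
  · intro p _ p' _ h
    exact C.rd_fiber_mul_injective q h
  · intro f hf
    obtain ⟨t, g, hg, rfl⟩ := C.mem_forestsOver_of_mul.1 ((Set.Finite.mem_toFinset _).1 hf)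
    exact ⟨(t, g), by simpa using hg, rfl⟩
  · intro p _
    exact E_mul K _ _

theorem toLinearMap_phiAlgHom : (C.phiAlgHom K).toLinearMap = C.phi K := by
  refine (E C.quotient K).ext fun x => ?_
  rw [AlgHom.toLinearMap_apply]
  induction x using FreeMonoid.recOn with
  | one =>
    rw [phi_E, E_one, map_one, ← E_one]
    simp only [forestsOver_one, Set.Finite.toFinset_singleton]
    exact (Finset.sum_singleton _ _).symm
  | of_mul q x ih =>
    rw [phi_E_of_mul, ← E_mul, map_mul, ih, phiAlgHom, lift_E, FreeMonoid.lift_eval_of]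

theorem fiberSum_unit : C.fiberSum K C.quotient.unit = 1 := by
  let t₀ : C.Fiber C.quotient.unit := ⟨(freeOperad S).unit, rfl⟩
  rw [fiberSum, Finset.sum_eq_single t₀]
  · rw [rd_unit, E_one]
  · rintro ⟨t, ht⟩ - h
    exact absurd (Subtype.ext ((C.proj_eq_unit_iff t).1 ht)) h
  · simp

/-- Extends the formula for generators to the unit class, needed because the factors in a coproduct
may be units. -/
theorem phiAlgHom_E_rd_singleton (q : C.quotient.carrier) :
    C.phiAlgHom K (E C.quotient K (C.quotient.rd [q])) = C.fiberSum K q := by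
  by_cases hq : q = C.quotient.unit
  · subst hq
    rw [rd_unit, E_one, map_one, fiberSum_unit]
  · rw [rd_singleton C.quotient ⟨q, hq⟩, phiAlgHom, lift_E, FreeMonoid.lift_eval_of]

theorem E_list_prod {O : NSOperad} (l : List O.ReducedWord) :
    E O K l.prod = (l.map (E O K)).prod := by
  induction l with
  | nil => exact E_one K
  | cons a l ih => rw [List.prod_cons, ← E_mul, ih, List.map_cons, List.prod_cons]

theorem E_rd_ofFn {O : NSOperad} {n : ℕ} (w : Fin n → O.carrier) :
    E O K (O.rd (List.ofFn w)) = (List.ofFn fun i => E O K (O.rd [w i])).prod := by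
  rw [rd_ofFn, E_list_prod, List.map_ofFn]
  rfl

/-- Expanding a product of sums yields a sum over choices of one element in each class. Unit letters
need no separate treatment: their fiber is the leaf alone, which `rd` deletes. -/
theorem phiAlgHom_E_rd_ofFn {n : ℕ} (w : Fin n → C.quotient.carrier) :
    C.phiAlgHom K (E C.quotient K (C.quotient.rd (List.ofFn w))) =
      ∑ p : ∀ i, C.Fiber (w i),
        E (freeOperad S) K ((freeOperad S).rd (List.ofFn fun i => (p i).1)) := by
  rw [E_rd_ofFn, map_list_prod, List.map_ofFn]
  simp only [E_rd_ofFn, Function.comp_def, phiAlgHom_E_rd_singleton]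
  exact prod_ofFn_sum _

end Morphism

/-! ### Lifting factorizations through a congruence -/

section Factorizations

variable {O : NSOperad} (C : O.Congruence)

/-- Factorizations of a class with a choice of an element in each class. -/
abbrev LiftedFactorization (q : C.quotient.carrier) :=
  (p : C.quotient.Factorization q) × C.Fiber p.1.1 × ∀ i, C.Fiber (p.1.2 i)

/-- The factorization of classes lifted by a factorization of an element of a class. -/
def liftFactorization (q : C.quotient.carrier) (p : (x : C.Fiber q) × O.Factorization x.1) :
    C.LiftedFactorization q :=
  ⟨⟨⟨C.proj p.2.1.1, fun i => C.proj (p.2.1.2 i)⟩,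
    (C.proj_comp _ _).symm.trans ((congrArg C.proj p.2.2).trans p.1.2)⟩,
    ⟨p.2.1.1, rfl⟩, fun i => ⟨p.2.1.2 i, rfl⟩⟩

theorem arity_eq_classArity {q : C.quotient.carrier} (x : C.Fiber q) : O.arity x.1 = C.classArity q :=
  congrArg C.classArity x.2

/-- The inverse composes the chosen elements: `y[u₁, …, uₙ]` lies in `q` because `proj` respects
composition, and no other element of `q` admits this factorization. -/
theorem liftFactorization_bijective (q : C.quotient.carrier) :
    Function.Bijective (C.liftFactorization q) := by
  constructor
  -- `G` keeps only the chosen elements, in a type that does not depend on the classes. They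
  -- determine the composite and hence all the rest.
  · let G : C.LiftedFactorization q → (y : O.carrier) × (Fin (O.arity y) → O.carrier) :=
      fun p => ⟨p.2.1.1, fun i => (p.2.2 (Fin.cast (C.arity_eq_classArity p.2.1) i)).1⟩
    have hG : ∀ p, G (C.liftFactorization q p) = p.2.1 := fun p => rfl
    rintro p p' h
    have h1 : p.2.1 = p'.2.1 := (hG p).symm.trans ((congrArg G h).trans (hG p'))
    obtain ⟨⟨x, hx⟩, ⟨p, hp⟩⟩ := p
    obtain ⟨⟨x', hx'⟩, ⟨p', hp'⟩⟩ := p'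
    simp only at h1 hp hp'
    subst h1 hp hp'
    rfl
  · rintro ⟨⟨⟨r, w⟩, h⟩, ⟨y, hy⟩, z⟩
    simp only at hy z h
    subst hy
    -- Separating the elements `u` from the proofs that they lie in the classes `w` allows `w` to be
    -- replaced by the projections of `u`.
    obtain ⟨u, hu, rfl⟩ : ∃ (u : Fin (O.arity y) → O.carrier) (hu : ∀ i, C.proj (u i) = w i),
        z = fun i => ⟨u i, hu i⟩ := ⟨fun i => (z i).1, fun i => (z i).2, rfl⟩
    obtain rfl : (fun i => C.proj (u i)) = w := funext hu
    exact ⟨⟨⟨O.comp y u, (C.proj_comp y u).trans h⟩, ⟨⟨y, u⟩, rfl⟩⟩, rfl⟩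

end Factorizations

/-! ### Compatibility with coproduct and counit -/

section Morphism

open NatHopf

variable (K : Type*) [CommRing K] [C.FiniteType] [C.CompatibleWithDegree]

/-- The right side runs over elements of `q` with a factorization, the left side over factorizations
of `q` with chosen elements; `liftFactorization` matches the two sums term by term. -/
theorem map_phiAlgHom_comulGen (q : C.quotient.carrier) :
    Algebra.TensorProduct.map (C.phiAlgHom K) (C.phiAlgHom K) (comulGen C.quotient K q) =
      comulHom (freeOperad S) K (C.fiberSum K q) := by
  have h1 : comulHom (freeOperad S) K (C.fiberSum K q) =
      ∑ p : (t : C.Fiber q) × (freeOperad S).Factorization t.1,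
        E (freeOperad S) K ((freeOperad S).rd [p.2.1.1]) ⊗ₜ[K]
          E (freeOperad S) K ((freeOperad S).rd (List.ofFn p.2.1.2)) := by
    rw [fiberSum, map_sum, Fintype.sum_sigma]
    simp only [comulHom_E_rd_singleton, comulGen_eq]
  have h2 : Algebra.TensorProduct.map (C.phiAlgHom K) (C.phiAlgHom K) (comulGen C.quotient K q) =
      ∑ p : C.LiftedFactorization q,
        E (freeOperad S) K ((freeOperad S).rd [p.2.1.1]) ⊗ₜ[K]
          E (freeOperad S) K ((freeOperad S).rd (List.ofFn fun i => (p.2.2 i).1)) := by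
    rw [comulGen_eq, map_sum, Fintype.sum_sigma]
    refine Finset.sum_congr rfl fun p _ => ?_
    rw [Algebra.TensorProduct.map_tmul, phiAlgHom_E_rd_singleton, phiAlgHom_E_rd_ofFn, fiberSum,
      TensorProduct.sum_tmul, Fintype.sum_prod_type]
    simp only [TensorProduct.tmul_sum]
  rw [h1, h2]
  exact ((C.liftFactorization_bijective q).sum_comp _).symm

/-- The map `phi` as a morphism of bialgebras. -/
def phiBialgHom : C.quotient.NatHopf K →ₐc[K] (freeOperad S).NatHopf K :=
  BialgHom.ofAlgHom (C.phiAlgHom K)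
    (algHom_ext K fun q => by
      change counitHom _ K (C.phiAlgHom K _) = counitHom _ K _
      -- Both counits vanish: `q` is not the unit class, so none of its elements is the leaf.
      rw [← rd_singleton, phiAlgHom_E_rd_singleton, fiberSum, map_sum, counitHom_E_rd,
        if_neg (by simpa using q.2)]
      refine Finset.sum_eq_zero fun t _ => ?_
      rw [counitHom_E_rd, if_neg]
      simp only [List.mem_singleton, forall_eq]
      exact fun h => q.2 (t.2.symm.trans ((C.proj_eq_unit_iff t.1).2 h)))
    (algHom_ext K fun q => by
      change Algebra.TensorProduct.map _ _ (comulHom _ K _) = comulHom _ K (C.phiAlgHom K _)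
      rw [← rd_singleton, phiAlgHom_E_rd_singleton, comulHom_E_rd_singleton,
        map_phiAlgHom_comulGen])

theorem phiBialgHom_apply (a : C.quotient.NatHopf K) : C.phiBialgHom K a = C.phi K a :=
  LinearMap.congr_fun (C.toLinearMap_phiAlgHom K) a

end Morphism

end NSOperad.Congruence

end

/-- The finiteness clause shows that the `finsum` defining `phi` is a genuine sum and not the
default value 0. -/
theorem mainTheorem2 {K : Type*} [Field K] [CharZero K] (S : Signature)
    (C : (freeOperad S).Congruence) [C.CompatibleWithDegree] [C.FiniteType] :
    (∀ x, (C.forestsOver x).Finite) ∧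
      Function.Injective (C.phi K) ∧
      ∃ Φ : C.quotient.NatHopf K →ₐc[K] (freeOperad S).NatHopf K,
        (∀ a, Φ a = C.phi K a) ∧
        ∀ a, Φ (HopfAlgebra.antipode K a) = HopfAlgebra.antipode K (Φ a) :=
  ⟨C.finite_forestsOver, C.phi_injective K, C.phiBialgHom K, C.phiBialgHom_apply K,
    (C.phiBialgHom K).map_antipode⟩
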